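/- Let $\mathbb Y$ be the set of all Young diagrams (partitions). For $\lambda\in\mathbb Y$ and integers $q,n\ge 0$, let $d^\lambda(q)$ be the number of fillings of $\lambda$ with labels from $\{1,\dots,q\}$ that are strictly increasing along rows and down columns, and let $e^\lambda(n)$ be the number of standard set-valued tableaux of shape $\lambda$: assignments of a nonempty subset of $\{1,\dots,n\}$ to each box such that each of $1,\dots,n$ is used exactly once and the largest entry of a box is smaller than every entry of the boxes directly to its right and directly below it. The Plancherel–Hecke measure $\mu_{n,q}$ on $\mathbb Y$ is given by $\mu_{n,q}(\lambda)=q^{-n}\,d^\lambda(q)\,e^\lambda(n)$. A typical shape of $\mu_{n,q}$ is a $\lambda\subseteq(q,q-1,\dots,1)$ that maximizes $\mu_{n,q}(\lambda)$ among such shapes. For $\lambda=(\lambda_1\ge\lambda_2\ge\cdots)$, with $\lambda_i=0$ for $i$ large, let $f_\lambda:[0,\infty)\to\mathbb R_{\ge0}$ be the piecewise linear function interpolating the points $(i,\lambda_{i+1})$, $i=0,1,2,\dots$, and put $\hat f_{\lambda,q}(x)=\frac1q f_\lambda(qx)$. **Theorem 1.6.** Let $0\le\alpha<\frac13$ and let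 $q=q(n)$ be a sequence of non-negative integers with $q(n)=\Theta(n^\alpha)$ as $n\to\infty$. Then: 1. A random shape under $\mu_{n,q(n)}$ is asymptotically almost surely the full staircase, i.e. $\lambda_i=q(n)-i+1$ for $1\le i\le q(n)$ and $\lambda_i=0$ for $i>q(n)$: as $n\to\infty$, $$\mu_{n,q(n)}\big(\{(q(n),q(n)-1,\dots,1)\}\big)\to1\quad\text{and}\quad \mu_{n,q(n)}\big(\mathbb Y\setminus\{(q(n),q(n)-1,\dots,1)\}\big)\to0.$$ 2. There is a unique continuous function $\Lambda:[0,\infty)\to\mathbb R_{\ge0}$ such that for every $\epsilon>0$ $$\mu_{n,q(n)}\Big(\Big\{\lambda:\ \sup_{x\ge0}\big|\hat f_{\lambda,q(n)}(x)-\Lambda(x)\big|>\epsilon\Big\}\Big)\to0\qquad(n\to\infty),$$ namely $\Lambda(x)=\max(1-x,0)$. 3. For all sufficiently large $n$ the staircase $(q(n),q(n)-1,\dots,1)$ is the unique typical shape of $\mu_{n,q(n)}$; and if $\Lambda_n$ is a typical shape of $\mu_{n,q(n)}$ for every $n$, then $\sup_{x\ge0}\big|\hat f_{\Lambda_n,q(n)}(x)-\max(1-x,0)\big|\to0$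 as $n\to\infty$. -/

import Mathlib

open Filter Topology MeasureTheory Asymptotics
open scoped NNReal ENNReal

namespace PlancherelHecke

/-- A filling `T` of the boxes of `lam` with the labels `1, …, q` (the label `k + 1` is represented
by `k : Fin q`) is an increasing tableau if it increases strictly along every row (left to right)
and down every column. The box in row `i` and column `j` is `(i, j)`, counted from `0`. -/
def IsIncreasing {lam : YoungDiagram} {q : ℕ} (T : lam.cells → Fin q) : Prop :=
  (∀ c d : lam.cells, c.1.1 = d.1.1 → c.1.2 < d.1.2 → T c < T d) ∧
  (∀ c d : lam.cells, c.1.2 = d.1.2 → c.1.1 < d.1.1 → T c < T d)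

/-- `d^lam(q)`: the number of increasing tableaux of shape `lam` with labels in `{1, …, q}`. -/
noncomputable def numInc (lam : YoungDiagram) (q : ℕ) : ℕ :=
  Nat.card {T : lam.cells → Fin q // IsIncreasing T}

/-- The box `d` is directly to the right of the box `c`, or directly below it. -/
def NextBox (c d : ℕ × ℕ) : Prop :=
  d = (c.1, c.2 + 1) ∨ d = (c.1 + 1, c.2)

/-- `S` assigns to each box of `lam` a set of labels from `1, …, n` (the label `k + 1` is
represented by `k : Fin n`). It is a standard set-valued tableau if every box gets a nonempty set,
every entry of a box is smaller than every entry of the boxes directly to the right of it and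
directly below it, and each label is used precisely once. -/
structure IsStandardSetValued {lam : YoungDiagram} {n : ℕ} (S : lam.cells → Finset (Fin n)) :
    Prop where
  nonempty : ∀ c, (S c).Nonempty
  lt_next : ∀ c d : lam.cells, NextBox c.1 d.1 → ∀ a ∈ S c, ∀ b ∈ S d, a < b
  existsUnique_box : ∀ k : Fin n, ∃! c, k ∈ S c

/-- `e^lam(n)`: the number of standard set-valued tableaux of shape `lam` with labels
`1, …, n`. -/
noncomputable def numStdSetValued (lam : YoungDiagram) (n : ℕ) : ℕ :=
  Nat.card {S : lam.cells → Finset (Fin n) // IsStandardSetValued S}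

/-- `Prob(lam) = d^lam(q) e^lam(n) / q^n`. -/
noncomputable def prob (n q : ℕ) (lam : YoungDiagram) : ℝ≥0 :=
  (numInc lam q : ℝ≥0) * (numStdSetValued lam n : ℝ≥0) / (q : ℝ≥0) ^ n

/-- Every set of Young diagrams is an event. -/
instance : MeasurableSpace YoungDiagram := ⊤

/-- The Plancherel–Hecke measure `μ_{n,q}` on the set of all Young diagrams: the discrete measure
with mass `prob n q lam` at each `lam`. -/
noncomputable def plancherelHecke (n q : ℕ) : Measure YoungDiagram :=
  Measure.sum fun lam => (prob n q lam : ℝ≥0∞) • Measure.dirac lam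

/-- The staircase shape `(q, q - 1, …, 2, 1)`: its boxes are the `(i, j)` with `i + j < q`. -/
def staircase (q : ℕ) : YoungDiagram where
  cells := (Finset.range q ×ˢ Finset.range q).filter fun c => c.1 + c.2 < q
  isLowerSet := by
    rintro ⟨i, j⟩ ⟨k, l⟩ ⟨h₁, h₂⟩ h
    simp only [Finset.coe_filter, Finset.mem_product, Finset.mem_range, Set.mem_ofPred_eq] at *
    omega

/-- A typical shape for `μ_{n,q}`: a shape contained in `(q, q - 1, …, 1)` that maximizes the
probability among these. -/
def IsTypicalShape (n q : ℕ) (lam : YoungDiagram) : Prop :=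
  lam ≤ staircase q ∧ ∀ ν : YoungDiagram, ν ≤ staircase q → prob n q ν ≤ prob n q lam

/-- The piecewise linear function on `[0, ∞)` attached to `lam = (lam_1 ≥ lam_2 ≥ …)`: it
interpolates linearly between the points `(i, lam_{i+1})`, `i = 0, 1, 2, …`, with `lam_i = 0` for
large `i`. (Mathlib's `lam.rowLen i` is `lam_{i+1}`.) -/
noncomputable def profile (lam : YoungDiagram) (x : ℝ≥0) : ℝ :=
  (1 - Int.fract (x : ℝ)) * (lam.rowLen ⌊x⌋₊ : ℝ) + Int.fract (x : ℝ) * (lam.rowLen (⌊x⌋₊ + 1) : ℝ)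

/-- The rescaling `x ↦ (1/q) f(x q)` of the profile `f` of `lam`. -/
noncomputable def rescaledProfile (q : ℕ) (lam : YoungDiagram) (x : ℝ≥0) : ℝ :=
  1 / (q : ℝ) * profile lam (x * (q : ℝ≥0))

/-- `sup_{x ≥ 0} |f̂(x) - Λ(x)| ∈ [0, ∞]`, where `f̂` is the profile of `lam` rescaled by `q`. -/
noncomputable def supDist (q : ℕ) (lam : YoungDiagram) (Λ : C(ℝ≥0, ℝ≥0)) : ℝ≥0∞ :=
  ⨆ x : ℝ≥0, ENNReal.ofReal |rescaledProfile q lam x - (Λ x : ℝ)|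

/-- `Λ` is a limit shape of the measures `μ_{n,q(n)}` (at scale `q(n)`) as `n → ∞`: for every
`ε > 0` the probability that the rescaled profile of a random shape has sup-distance more than `ε`
from `Λ` tends to `0`. -/
def IsLimitShape (q : ℕ → ℕ) (Λ : C(ℝ≥0, ℝ≥0)) : Prop :=
  ∀ ε : ℝ, 0 < ε →
    Tendsto (fun n => plancherelHecke n (q n) {lam | ENNReal.ofReal ε < supDist (q n) lam Λ})
      atTop (𝓝 0)

/-- The line `y = 1 - x` for `0 ≤ x ≤ 1`, continued by `0` for `x ≥ 1`. -/
noncomputable def line : C(ℝ≥0, ℝ≥0) where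
  toFun x := Real.toNNReal (1 - (x : ℝ))
  continuous_toFun := by fun_prop

end PlancherelHecke

open PlancherelHecke

namespace PlancherelHecke

/-! For q > 0 the measure is the law at time n of a growth process. Deleting the largest label of a
set-valued tableau shows that e^λ(n) counts walks in Young's lattice whose steps add a box or stay
and mark a corner (`walkCount`); deleting all boxes with the largest label gives a recursion for
d^λ(q) (`incCount`). The key identity `sum_incCount_insert` makes d, for fixed q, an eigenvector
with eigenvalue q of the matching operator. Hence the masses sum to 1, and μ_{n,q} is the law of the
Markov chain started at ∅ that moves from A to A + b with probability d(A + b) / (q d(A)) and stays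
at A with probability (number of corners of A) / q.

Inside the staircase only the staircase itself has q corners (`IsDiagram.card_corners_lt`). It is
therefore absorbing, and everywhere else the chain grows with probability at least 1/q. Let P_n be
the probability that absorption has not occurred by time n. It does not increase with n
(`properWeight_succ_le`), while the expected size grows by at least P_n / q in each step
(`sizeWeight_succ_ge`) and never exceeds q². Hence n P_n ≤ q³, and q³ / n → 0 because α < 1/3.

The limit shape and the typical shape follow at once: the rescaled profile of the staircase is
exactly max(1 - x, 0), and a shape carrying more than half of the mass is the unique maximizer. -/

/-! ### Diagrams, corners and addable boxes. -/

lemma nextBox_right (i j : ℕ) : NextBox (i, j) (i, j + 1) := Or.inl rfl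

lemma nextBox_down (i j : ℕ) : NextBox (i, j) (i + 1, j) := Or.inr rfl

lemma not_nextBox_self (c : ℕ × ℕ) : ¬ NextBox c c := by
  rcases c with ⟨i, j⟩
  simp [NextBox]

lemma NextBox.le {c d : ℕ × ℕ} (h : NextBox c d) : c ≤ d := by
  rcases c with ⟨i, j⟩
  rcases h with rfl | rfl <;> simp [Prod.le_def]

/-- A finite set of boxes is a diagram if it is a lower set. -/
abbrev IsDiagram (A : Finset (ℕ × ℕ)) : Prop := IsLowerSet (A : Set (ℕ × ℕ))

lemma IsDiagram.mem_of_le {A : Finset (ℕ × ℕ)} (hA : IsDiagram A) {c d : ℕ × ℕ} (h : c ≤ d)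
    (hd : d ∈ A) : c ∈ A := hA h hd

lemma isDiagram_of_nextBox {A : Finset (ℕ × ℕ)}
    (h : ∀ c d, NextBox c d → d ∈ A → c ∈ A) : IsDiagram A := by
  have key : ∀ a b i j : ℕ, (i + a, j + b) ∈ A → (i, j) ∈ A := by
    intro a
    induction a with
    | zero =>
      intro b
      induction b with
      | zero => intro i j h; exact h
      | succ b ih => intro i j hij; exact ih i j (h _ _ (nextBox_right _ _) hij)
    | succ a ih => intro b i j hij; exact ih b i j (h _ _ (nextBox_down _ _) (by
        convert hij using 2; omega))
  rintro ⟨k, l⟩ ⟨i, j⟩ ⟨h₁, h₂⟩ hkl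
  simp only at h₁ h₂
  refine key (k - i) (l - j) i j ?_
  have e₁ : i + (k - i) = k := by omega
  have e₂ : j + (l - j) = l := by omega
  rw [e₁, e₂]
  exact hkl

open scoped Classical in
/-- The boxes of `A` with no box of `A` directly to the right or directly below. -/
noncomputable def corners (A : Finset (ℕ × ℕ)) : Finset (ℕ × ℕ) :=
  A.filter fun a => ∀ d, NextBox a d → d ∉ A

open scoped Classical in
/-- The boxes outside of `A` whose left and upper neighbours all lie in `A`. -/
noncomputable def addable (A : Finset (ℕ × ℕ)) : Finset (ℕ × ℕ) :=
  (insert (0, 0) (A.image (fun c => (c.1, c.2 + 1)) ∪ A.image (fun c => (c.1 + 1, c.2)))).filter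
    fun b => b ∉ A ∧ ∀ c, NextBox c b → c ∈ A

lemma mem_corners {A : Finset (ℕ × ℕ)} {a : ℕ × ℕ} :
    a ∈ corners A ↔ a ∈ A ∧ ∀ d, NextBox a d → d ∉ A := by
  simp [corners]

lemma mem_addable {A : Finset (ℕ × ℕ)} {b : ℕ × ℕ} :
    b ∈ addable A ↔ b ∉ A ∧ ∀ c, NextBox c b → c ∈ A := by
  classical
  simp only [addable, Finset.mem_filter, and_iff_right_iff_imp]
  rintro ⟨-, h⟩
  rcases b with ⟨_ | i, _ | j⟩
  · simp
  · refine Finset.mem_insert_of_mem (Finset.mem_union_left _ ?_)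
    exact Finset.mem_image.2 ⟨(0, j), h _ (nextBox_right _ _), rfl⟩
  all_goals
    refine Finset.mem_insert_of_mem (Finset.mem_union_right _ ?_)
    exact Finset.mem_image.2 ⟨(i, _), h _ (nextBox_down _ _), rfl⟩

lemma corners_subset (A : Finset (ℕ × ℕ)) : corners A ⊆ A := fun _ h => (mem_corners.1 h).1

lemma IsDiagram.sdiff {A S : Finset (ℕ × ℕ)} (hA : IsDiagram A) (hS : S ⊆ corners A) :
    IsDiagram (A \ S) := by
  refine isDiagram_of_nextBox fun c d h hd => ?_
  rw [Finset.mem_sdiff] at hd ⊢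
  exact ⟨hA.mem_of_le h.le hd.1, fun hc => (mem_corners.1 (hS hc)).2 d h hd.1⟩

lemma IsDiagram.insert {A : Finset (ℕ × ℕ)} (hA : IsDiagram A) {b : ℕ × ℕ} (hb : b ∈ addable A) :
    IsDiagram (insert b A) := by
  refine isDiagram_of_nextBox fun c d h hd => ?_
  rcases Finset.mem_insert.1 hd with rfl | hd
  · exact Finset.mem_insert_of_mem ((mem_addable.1 hb).2 c h)
  · exact Finset.mem_insert_of_mem (hA.mem_of_le h.le hd)

lemma IsDiagram.self_mem_corners_insert {A : Finset (ℕ × ℕ)} (hA : IsDiagram A) {b : ℕ × ℕ}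
    (hb : b ∈ addable A) : b ∈ corners (Insert.insert b A) := by
  rw [mem_addable] at hb
  refine mem_corners.2 ⟨Finset.mem_insert_self _ _, fun d h hd => ?_⟩
  rcases Finset.mem_insert.1 hd with rfl | hd
  · exact not_nextBox_self _ h
  · exact hb.1 (hA.mem_of_le h.le hd)

lemma IsDiagram.mem_addable_erase {A : Finset (ℕ × ℕ)} (hA : IsDiagram A) {b : ℕ × ℕ}
    (hb : b ∈ corners A) : b ∈ addable (A.erase b) := by
  rw [mem_corners] at hb
  refine mem_addable.2 ⟨Finset.notMem_erase _ _, fun c h => Finset.mem_erase.2 ⟨?_, ?_⟩⟩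
  · rintro rfl; exact not_nextBox_self _ h
  · exact hA.mem_of_le h.le hb.1

/-- A diagram has one more addable box than it has corners. -/
lemma IsDiagram.card_addable {A : Finset (ℕ × ℕ)} (hA : IsDiagram A) :
    (addable A).card = (corners A).card + 1 := by
  let μ : YoungDiagram := ⟨A, hA⟩
  have hμ : ∀ i j, (i, j) ∈ A ↔ j < μ.rowLen i := fun i j => by
    rw [← YoungDiagram.mem_iff_lt_rowLen]; exact Iff.rfl
  -- The addable box at the end of the top row is the extra one; the others are matched with
  -- corners.
  have hzero : (0, μ.rowLen 0) ∈ addable A := by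
    refine mem_addable.2 ⟨by simp [hμ], ?_⟩
    rintro ⟨i, j⟩ h
    rw [hμ]
    rcases h with h | h
    · simp only [Prod.mk.injEq] at h
      obtain ⟨rfl, h⟩ := h
      omega
    · simp at h
  rw [← Finset.card_erase_add_one hzero]
  congr 1
  symm
  -- A corner in row i means that row i + 1 is strictly shorter, which is exactly when row i + 1 can
  -- be extended.
  refine Finset.card_bij (fun c _ => (c.1 + 1, μ.rowLen (c.1 + 1))) ?_ ?_ ?_
  · rintro ⟨i, j⟩ h
    rw [mem_corners, hμ] at h
    have h₁ := h.2 _ (nextBox_down _ _)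
    rw [hμ] at h₁
    refine Finset.mem_erase.2 ⟨by simp, mem_addable.2 ⟨by simp [hμ], ?_⟩⟩
    rintro ⟨k, l⟩ hkl
    rw [hμ]
    rcases hkl with hkl | hkl
    · simp only [Prod.mk.injEq] at hkl
      obtain ⟨rfl, hkl⟩ := hkl
      omega
    · simp only [Prod.mk.injEq, add_left_inj] at hkl
      obtain ⟨rfl, hkl⟩ := hkl
      omega
  · rintro ⟨i, j⟩ h ⟨k, l⟩ h' hik
    simp only [Prod.mk.injEq, add_left_inj] at hik
    obtain ⟨rfl, -⟩ := hik
    rw [mem_corners, hμ] at h h'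
    have h₁ := h.2 _ (nextBox_right _ _)
    have h₂ := h'.2 _ (nextBox_right _ _)
    rw [hμ] at h₁ h₂
    simp only [Prod.mk.injEq, true_and]
    omega
  · rintro ⟨_ | i, j⟩ h
    · exfalso
      rw [Finset.mem_erase, mem_addable, hμ] at h
      obtain ⟨hne, h₁, h₂⟩ := h
      cases j with
      | zero => simp only [ne_eq, Prod.mk.injEq, true_and] at hne; omega
      | succ j =>
        have := h₂ _ (nextBox_right _ _)
        rw [hμ] at this
        simp only [ne_eq, Prod.mk.injEq, true_and] at hne
        omega
    · rw [Finset.mem_erase, mem_addable, hμ] at h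
      obtain ⟨-, h₁, h₂⟩ := h
      have h₃ := h₂ _ (nextBox_down _ _)
      rw [hμ] at h₃
      have hj : j = μ.rowLen (i + 1) := by
        cases j with
        | zero => omega
        | succ j =>
          have := h₂ _ (nextBox_right _ _)
          rw [hμ] at this
          omega
      refine ⟨(i, μ.rowLen i - 1), mem_corners.2 ⟨by rw [hμ]; omega, ?_⟩, by simp [hj]⟩
      rintro ⟨k, l⟩ hkl
      rw [hμ]
      rcases hkl with hkl | hkl <;> simp only [Prod.mk.injEq] at hkl <;>
        obtain ⟨rfl, rfl⟩ := hkl <;> omega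

/-! ### Increasing fillings as an eigenvector of the up-operator. -/

/-- The number of chains of diagrams from `∅` to `A` in `q` steps, each of which adds a set of
boxes that are corners of the new diagram. -/
noncomputable def incCount : ℕ → Finset (ℕ × ℕ) → ℕ
  | 0, A => if A = ∅ then 1 else 0
  | q + 1, A => ∑ S ∈ (corners A).powerset, incCount q (A \ S)

lemma incCount_succ (q : ℕ) (A : Finset (ℕ × ℕ)) :
    incCount (q + 1) A = ∑ S ∈ (corners A).powerset, incCount q (A \ S) := rfl

/-- Double counting: putting s back into `A \ S` amounts to removing only S \ {s}, and a given S' ⊆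
C arises in this way once for every s in C \ S'. -/
lemma sum_powerset_sum_insert_sdiff (C A : Finset (ℕ × ℕ)) (hC : C ⊆ A)
    (f : Finset (ℕ × ℕ) → ℤ) :
    ∑ S ∈ C.powerset, ∑ s ∈ S, f (insert s (A \ S)) =
      ∑ S ∈ C.powerset, ((C.card : ℤ) - S.card) * f (A \ S) := by
  have h : ∀ S ∈ C.powerset, ((C.card : ℤ) - S.card) * f (A \ S) = ∑ _s ∈ C \ S, f (A \ S) := by
    intro S hS
    rw [Finset.mem_powerset] at hS
    rw [Finset.sum_const, nsmul_eq_mul, Finset.cast_card_sdiff hS]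
  rw [Finset.sum_congr rfl h, Finset.sum_sigma', Finset.sum_sigma']
  refine Finset.sum_bij' (fun x _ => ⟨x.1.erase x.2, x.2⟩) (fun x _ => ⟨insert x.2 x.1, x.2⟩)
    ?_ ?_ ?_ ?_ ?_
  · rintro ⟨S, s⟩ h
    simp only [Finset.mem_sigma, Finset.mem_powerset, Finset.mem_sdiff, Finset.mem_erase] at h ⊢
    exact ⟨(Finset.erase_subset _ _).trans h.1, h.1 h.2, by simp⟩
  · rintro ⟨S, s⟩ h
    simp only [Finset.mem_sigma, Finset.mem_powerset, Finset.mem_sdiff] at h ⊢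
    exact ⟨Finset.insert_subset h.2.1 h.1, Finset.mem_insert_self _ _⟩
  · rintro ⟨S, s⟩ h
    simp only [Finset.mem_sigma, Finset.mem_powerset] at h
    simp [Finset.insert_erase h.2]
  · rintro ⟨S, s⟩ h
    simp only [Finset.mem_sigma, Finset.mem_powerset, Finset.mem_sdiff] at h
    simp [Finset.erase_insert h.2.2]
  · rintro ⟨S, s⟩ h
    simp only [Finset.mem_sigma, Finset.mem_powerset] at h
    congr 1
    ext x
    have := hC (h.1 h.2)
    simp only [Finset.mem_insert, Finset.mem_sdiff, Finset.mem_erase]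
    by_cases hx : x = s
    · subst hx; simp [this]
    · simp [hx]

/-- For a fixed number `q` of labels the counts of increasing fillings form an eigenvector of the
weighted up-operator of Young's lattice with a loop for each corner. -/
lemma sum_incCount_insert (q : ℕ) {A : Finset (ℕ × ℕ)} (hA : IsDiagram A) :
    ∑ b ∈ addable A, incCount q (insert b A) + (corners A).card * incCount q A =
      q * incCount q A := by
  induction q generalizing A with
  | zero =>
    have h : ∀ b ∈ addable A, incCount 0 (insert b A) = 0 := fun b _ => by simp [incCount]
    rw [Finset.sum_congr rfl h]
    by_cases hA₀ : A = ∅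
    · subst hA₀; simp [corners]
    · simp [incCount, hA₀]
  | succ q ih =>
    -- The corners of A + b other than b are the corners of A not adjacent to b. A removed set
    -- either omits b or contains it, which gives the two summands; exchanging the sums puts S
    -- outside.
    have hup : ∑ b ∈ addable A, incCount (q + 1) (insert b A) =
        ∑ S ∈ (corners A).powerset, ∑ b ∈ addable A ∩ addable (A \ S),
          (incCount q (insert b (A \ S)) + incCount q (A \ S)) := by
      rw [← Finset.sum_comm' (s := addable A)
        (t := fun b => ((corners (insert b A)).erase b).powerset)]
      · refine Finset.sum_congr rfl fun b hb => ?_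
        have hbA := (mem_addable.1 hb).1
        rw [incCount_succ, ← Finset.insert_erase (hA.self_mem_corners_insert hb),
          Finset.sum_powerset_insert (Finset.notMem_erase _ _), ← Finset.sum_add_distrib,
          Finset.erase_insert (Finset.notMem_erase _ _)]
        refine Finset.sum_congr rfl fun S hS => ?_
        rw [Finset.mem_powerset] at hS
        have hbS : b ∉ S := fun h => Finset.notMem_erase b _ (hS h)
        rw [Finset.insert_sdiff_of_notMem _ hbS, Finset.insert_sdiff_insert,
          Finset.sdiff_insert_of_notMem hbA]
      · intro b S
        simp only [Finset.mem_inter, Finset.mem_powerset]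
        constructor
        · rintro ⟨hb, hS⟩
          have hS' : ∀ s ∈ S, s ∈ A ∧ ∀ d, NextBox s d → d ≠ b ∧ d ∉ A := by
            intro s hs
            have := hS hs
            simp only [Finset.mem_erase, mem_corners, Finset.mem_insert, not_or] at this
            exact ⟨this.2.1.resolve_left this.1, this.2.2⟩
          refine ⟨⟨hb, mem_addable.2 ⟨?_, ?_⟩⟩, fun s hs => mem_corners.2
            ⟨(hS' s hs).1, fun d h => ((hS' s hs).2 d h).2⟩⟩
          · simp [(mem_addable.1 hb).1]
          · exact fun c hc => Finset.mem_sdiff.2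
              ⟨(mem_addable.1 hb).2 c hc, fun hs => ((hS' c hs).2 b hc).1 rfl⟩
        · rintro ⟨⟨hb, hb'⟩, hS⟩
          refine ⟨hb, fun s hs => ?_⟩
          have hsA := mem_corners.1 (hS hs)
          simp only [Finset.mem_erase, mem_corners, Finset.mem_insert, not_or]
          refine ⟨?_, Or.inr hsA.1, fun d hd => ⟨?_, hsA.2 d hd⟩⟩
          · rintro rfl; exact (mem_addable.1 hb).1 hsA.1
          · rintro rfl
            exact (Finset.mem_sdiff.1 ((mem_addable.1 hb').2 s hd)).2 hs
    -- A box that can be added to `A \ S` is either one just removed or was addable to A already.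
    have hadd : ∀ S ∈ (corners A).powerset, addable (A \ S) = S ∪ addable A ∩ addable (A \ S) ∧
        Disjoint S (addable A ∩ addable (A \ S)) := by
      intro S hS
      rw [Finset.mem_powerset] at hS
      constructor
      · ext b
        simp only [Finset.mem_union, Finset.mem_inter]
        constructor
        · intro hb
          by_cases hbS : b ∈ S
          · exact Or.inl hbS
          · refine Or.inr ⟨mem_addable.2 ⟨fun h => ?_, fun c hc => ?_⟩, hb⟩
            · exact (mem_addable.1 hb).1 (Finset.mem_sdiff.2 ⟨h, hbS⟩)
            · exact (Finset.mem_sdiff.1 ((mem_addable.1 hb).2 c hc)).1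
        · rintro (hb | hb)
          · have hbA := (mem_corners.1 (hS hb)).1
            refine mem_addable.2 ⟨by simp [hb], fun c hc => Finset.mem_sdiff.2
              ⟨hA.mem_of_le hc.le hbA, fun hcS => (mem_corners.1 (hS hcS)).2 b hc hbA⟩⟩
          · exact hb.2
      · refine Finset.disjoint_left.2 fun s hs hs' => ?_
        exact (mem_addable.1 (Finset.mem_inter.1 hs').1).1 (mem_corners.1 (hS hs)).1
    -- The induction hypothesis for `A \ S` runs over all its addable boxes, so those in S are
    -- subtracted. The corner count of `A \ S` cancels through `card_addable`, whose extra 1 turns q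
    -- into q + 1.
    have hterm : ∀ S ∈ (corners A).powerset, ((∑ b ∈ addable A ∩ addable (A \ S),
        (incCount q (insert b (A \ S)) + incCount q (A \ S)) : ℕ) : ℤ) =
        (q + 1 - S.card) * (incCount q (A \ S) : ℤ) -
          ∑ s ∈ S, (incCount q (insert s (A \ S)) : ℤ) := by
      intro S hS
      obtain ⟨h₁, h₂⟩ := hadd S hS
      have hD := hA.sdiff (Finset.mem_powerset.1 hS)
      have h₃ := hD.card_addable
      have h₄ := ih hD
      rw [h₁, Finset.card_union_of_disjoint h₂] at h₃
      rw [h₁, Finset.sum_union h₂] at h₄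
      zify at h₃ h₄
      push_cast
      rw [Finset.sum_add_distrib, Finset.sum_const, nsmul_eq_mul]
      linear_combination h₄ + (incCount q (A \ S) : ℤ) * h₃
    have hswap := sum_powerset_sum_insert_sdiff (corners A) A (corners_subset A)
      (fun B => (incCount q B : ℤ))
    zify
    rw [← Nat.cast_sum, hup, Nat.cast_sum, Finset.sum_congr rfl hterm, Finset.sum_sub_distrib,
      hswap, incCount_succ, ← Finset.sum_sub_distrib]
    push_cast
    rw [Finset.mul_sum, Finset.mul_sum, ← Finset.sum_add_distrib]
    refine Finset.sum_congr rfl fun S _ => ?_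
    ring

/-! ### The staircase: support of the weights and extremality. -/

lemma mem_staircase {q : ℕ} {c : ℕ × ℕ} : c ∈ (staircase q).cells ↔ c.1 + c.2 < q := by
  simp only [staircase, Finset.mem_filter, Finset.mem_product, Finset.mem_range,
    and_iff_right_iff_imp]
  omega

/-- A box enters the chain strictly after its left and upper neighbours, so i + j rises by at most
one per step. -/
lemma IsDiagram.subset_staircase_of_incCount_ne_zero {q : ℕ} {A : Finset (ℕ × ℕ)}
    (hA : IsDiagram A) (h : incCount q A ≠ 0) : A ⊆ (staircase q).cells := by
  induction q generalizing A with
  | zero =>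
    by_cases hA₀ : A = ∅
    · simp [hA₀]
    · simp [incCount, hA₀] at h
  | succ q ih =>
    rw [incCount_succ] at h
    obtain ⟨S, hS, hne⟩ := Finset.exists_ne_zero_of_sum_ne_zero h
    rw [Finset.mem_powerset] at hS
    have hsub := ih (hA.sdiff hS) hne
    have key : ∀ c d, NextBox c d → d ∈ A → c.1 + c.2 < q := fun c d hcd hd =>
      mem_staircase.1 (hsub (Finset.mem_sdiff.2 ⟨hA.mem_of_le hcd.le hd, fun hc =>
        (mem_corners.1 (hS hc)).2 d hcd hd⟩))
    rintro ⟨_ | i, _ | j⟩ hij <;> rw [mem_staircase]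
    · simp
    · have := key _ _ (nextBox_right _ _) hij
      simp only at this ⊢
      omega
    all_goals
      have := key _ _ (nextBox_down _ _) hij
      simp only at this ⊢
      omega

/-- Among the diagrams inside the staircase, only the staircase itself has `q` corners. -/
lemma IsDiagram.card_corners_lt {q : ℕ} {A : Finset (ℕ × ℕ)} (hA : IsDiagram A)
    (hsub : A ⊆ (staircase q).cells) (hne : A ≠ (staircase q).cells) : (corners A).card < q := by
  by_contra! hq
  apply hne
  have hinj : Set.InjOn Prod.fst (corners A : Set (ℕ × ℕ)) := by
    rintro ⟨i, j⟩ h ⟨k, l⟩ h' (rfl : i = k)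
    rw [Finset.mem_coe, mem_corners] at h h'
    by_contra hjl
    rcases lt_or_gt_of_ne (show j ≠ l by rintro rfl; exact hjl rfl) with hlt | hlt
    · exact h.2 _ (nextBox_right _ _) (hA.mem_of_le (by simp [Prod.le_def]; omega) h'.1)
    · exact h'.2 _ (nextBox_right _ _) (hA.mem_of_le (by simp [Prod.le_def]; omega) h.1)
  -- Corners lie in distinct rows, and only rows below q are available, so q corners occupy every
  -- row.
  have himg : (corners A).image Prod.fst = Finset.range q := by
    refine Finset.eq_of_subset_of_card_le (fun i hi => ?_) ?_
    · obtain ⟨c, hc, rfl⟩ := Finset.mem_image.1 hi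
      have := mem_staircase.1 (hsub (corners_subset A hc))
      rw [Finset.mem_range]
      omega
    · rw [Finset.card_range, Finset.card_image_of_injOn hinj]
      exact hq
  have hrow : ∀ i < q, ∃ j, (i, j) ∈ corners A := by
    intro i hi
    rw [← Finset.mem_range, ← himg] at hi
    obtain ⟨c, hc, rfl⟩ := Finset.mem_image.1 hi
    exact ⟨c.2, hc⟩
  -- Upwards from the bottom row: the corner of row i has no box below it, so it lies strictly to
  -- the right of the box (i + 1, k) already found.
  have hdiag : ∀ k i, i + k + 1 = q → (i, k) ∈ A := by
    intro k
    induction k with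
    | zero =>
      intro i hi
      obtain ⟨j, hj⟩ := hrow i (by omega)
      exact hA.mem_of_le (by simp [Prod.le_def]) (corners_subset A hj)
    | succ k ih =>
      intro i hi
      obtain ⟨j, hj⟩ := hrow i (by omega)
      have h₁ := ih (i + 1) (by omega)
      have h₂ : k + 1 ≤ j := by
        by_contra! hlt
        exact (mem_corners.1 hj).2 _ (nextBox_down _ _)
          (hA.mem_of_le (by simp [Prod.le_def]; omega) h₁)
      exact hA.mem_of_le (by simp [Prod.le_def, h₂]) (corners_subset A hj)
  refine hsub.antisymm fun c hc => ?_
  have := mem_staircase.1 hc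
  exact hA.mem_of_le (by simp [Prod.le_def]; omega) (hdiag (q - 1 - c.1) c.1 (by omega))

/-! ### Identification of `numInc` with `incCount`. -/

/-- `d` lies in the row of `c` to the right of `c`, or in the column of `c` below `c`. -/
def Beyond (c d : ℕ × ℕ) : Prop := (c.1 = d.1 ∧ c.2 < d.2) ∨ (c.2 = d.2 ∧ c.1 < d.1)

lemma NextBox.beyond {c d : ℕ × ℕ} (h : NextBox c d) : Beyond c d := by
  rcases h with rfl | rfl <;> simp [Beyond]

lemma Beyond.exists_nextBox {c d : ℕ × ℕ} (h : Beyond c d) : ∃ e, NextBox c e ∧ e ≤ d := by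
  rcases c with ⟨i, j⟩
  rcases h with h | h
  · exact ⟨_, nextBox_right _ _, by simp only [Prod.le_def] at *; omega⟩
  · exact ⟨_, nextBox_down _ _, by simp only [Prod.le_def] at *; omega⟩

/-- Increasing fillings of `A` with labels `0, …, q - 1`, extended by `q` outside of `A`. -/
abbrev IncFilling (q : ℕ) (A : Finset (ℕ × ℕ)) : Type :=
  {T : ℕ × ℕ → ℕ // (∀ c ∈ A, T c < q) ∧ (∀ c ∉ A, T c = q) ∧
    ∀ c ∈ A, ∀ d ∈ A, Beyond c d → T c < T d}

instance (q : ℕ) (A : Finset (ℕ × ℕ)) : Finite (IncFilling q A) := by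
  refine Finite.of_injective (β := A → Fin q) (fun T c => ⟨T.1 c, T.2.1 c c.2⟩) fun T T' h => ?_
  refine Subtype.ext (funext fun c => ?_)
  by_cases hc : c ∈ A
  · simpa using congrFun h ⟨c, hc⟩
  · rw [T.2.2.1 c hc, T'.2.2.1 c hc]

/-- The boxes with the top label q form a set S of corners, possibly empty, and the rest is a
filling of `A \ S` with labels below q. -/
lemma card_incFilling_succ (q : ℕ) {A : Finset (ℕ × ℕ)} (hA : IsDiagram A) :
    Nat.card (IncFilling (q + 1) A) =
      ∑ S ∈ (corners A).powerset, Nat.card (IncFilling q (A \ S)) := by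
  rw [← Finset.sum_coe_sort, ← Nat.card_sigma]
  symm
  have hlt : ∀ (S : (corners A).powerset) (T : IncFilling q (A \ S)), ∀ c, T.1 c ≤ q := by
    intro S T c
    by_cases hc : c ∈ A \ S.1
    · exact (T.2.1 c hc).le
    · exact (T.2.2.1 c hc).le
  refine Nat.card_eq_of_bijective
    (fun x => ⟨fun c => if c ∈ A then x.2.1 c else q + 1, ?_, ?_, ?_⟩) ⟨?_, ?_⟩
  · intro c hc
    simp only [hc, if_true]
    exact Nat.lt_succ_of_le (hlt _ _ _)
  · intro c hc
    simp [hc]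
  · obtain ⟨⟨S, hS⟩, T, hT₁, hT₂, hT₃⟩ := x
    intro c hc d hd hcd
    rw [Finset.mem_powerset] at hS
    simp only [hc, hd, if_true]
    have hcS : c ∉ S := fun h => by
      obtain ⟨e, he, hed⟩ := hcd.exists_nextBox
      exact (mem_corners.1 (hS h)).2 e he (hA.mem_of_le hed hd)
    have hc' : c ∈ A \ S := Finset.mem_sdiff.2 ⟨hc, hcS⟩
    by_cases hdS : d ∈ S
    · rw [hT₂ d (by simp [hdS])]
      exact hT₁ c hc'
    · exact hT₃ c hc' d (Finset.mem_sdiff.2 ⟨hd, hdS⟩) hcd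
  · rintro ⟨⟨S, hS⟩, T⟩ ⟨⟨S', hS'⟩, T'⟩ h
    have hval : ∀ c ∈ A, T.1 c = T'.1 c := fun c hc => by
      simpa [hc] using congrFun (congrArg Subtype.val h) c
    rw [Finset.mem_powerset] at hS hS'
    have hmem : ∀ (R : Finset (ℕ × ℕ)) (_ : R ⊆ corners A) (X : IncFilling q (A \ R)) (c),
        c ∈ R ↔ c ∈ A ∧ X.1 c = q := by
      intro R hR X c
      refine ⟨fun hc => ⟨corners_subset A (hR hc), X.2.2.1 c (by simp [hc])⟩, fun hc => ?_⟩
      by_contra hcR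
      exact (X.2.1 c (Finset.mem_sdiff.2 ⟨hc.1, hcR⟩)).ne hc.2
    have hSS : S = S' := by
      ext c
      rw [hmem S hS T, hmem S' hS' T']
      exact and_congr_right fun hc => by rw [hval c hc]
    subst hSS
    congr 1
    refine Subtype.ext (funext fun c => ?_)
    by_cases hc : c ∈ A
    · exact hval c hc
    · rw [T.2.2.1 c (by simp [hc]), T'.2.2.1 c (by simp [hc])]
  · rintro ⟨T, hT₁, hT₂, hT₃⟩
    have hS : A.filter (fun c => T c = q) ⊆ corners A := by
      intro c hc
      rw [Finset.mem_filter] at hc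
      refine mem_corners.2 ⟨hc.1, fun d hcd hd => ?_⟩
      have h₁ := hT₃ c hc.1 d hd hcd.beyond
      have h₂ := hT₁ d hd
      omega
    -- Truncation at q lowers only the default value q + 1 outside A, and boxes of S already carry
    -- q, the default value for `A \ S`.
    refine ⟨⟨⟨_, Finset.mem_powerset.2 hS⟩, fun c => min (T c) q, ?_, ?_, ?_⟩, ?_⟩
    · intro c hc
      simp only [Finset.mem_sdiff, Finset.mem_filter, not_and] at hc
      have h₁ := hc.2 hc.1
      have h₂ := hT₁ c hc.1
      change min (T c) q < q
      omega
    · intro c hc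
      simp only [Finset.mem_sdiff, Finset.mem_filter, not_and, not_forall, not_not] at hc
      change min (T c) q = q
      by_cases hcA : c ∈ A
      · obtain ⟨-, h⟩ := hc hcA
        omega
      · have := hT₂ c hcA
        omega
    · intro c hc d hd hcd
      simp only [Finset.mem_sdiff, Finset.mem_filter, not_and] at hc hd
      have h₁ := hT₃ c hc.1 d hd.1 hcd
      have h₂ := hT₁ d hd.1
      have h₃ := hc.2 hc.1
      have h₄ := hd.2 hd.1
      change min (T c) q < min (T d) q
      omega
    · refine Subtype.ext (funext fun c => ?_)
      by_cases hc : c ∈ A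
      · have := hT₁ c hc
        simp only [hc, if_true]
        omega
      · simp [hc, hT₂ c hc]

lemma card_incFilling (q : ℕ) {A : Finset (ℕ × ℕ)} (hA : IsDiagram A) :
    Nat.card (IncFilling q A) = incCount q A := by
  induction q generalizing A with
  | zero =>
    by_cases h : A = ∅
    · subst h
      simp only [incCount, if_true]
      rw [Nat.card_eq_one_iff_exists]
      refine ⟨⟨fun _ => 0, by simp⟩, fun T => Subtype.ext (funext fun c => ?_)⟩
      exact T.2.2.1 c (by simp)
    · simp only [incCount, h, if_false]
      obtain ⟨c, hc⟩ := Finset.nonempty_iff_ne_empty.2 h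
      have : IsEmpty (IncFilling 0 A) := ⟨fun T => Nat.not_lt_zero _ (T.2.1 c hc)⟩
      exact Nat.card_of_isEmpty
  | succ q ih =>
    rw [card_incFilling_succ q hA, incCount_succ]
    exact Finset.sum_congr rfl fun S hS => ih (hA.sdiff (Finset.mem_powerset.1 hS))

lemma numInc_eq_incCount (lam : YoungDiagram) (q : ℕ) : numInc lam q = incCount q lam.cells := by
  rw [← card_incFilling q lam.isLowerSet, numInc]
  symm
  refine Nat.card_eq_of_bijective
    (fun T => ⟨fun c => ⟨T.1 c, T.2.1 c c.2⟩, ?_, ?_⟩) ⟨?_, ?_⟩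
  · exact fun c d h₁ h₂ => T.2.2.2 c c.2 d d.2 (Or.inl ⟨h₁, h₂⟩)
  · exact fun c d h₁ h₂ => T.2.2.2 c c.2 d d.2 (Or.inr ⟨h₁, h₂⟩)
  · intro T T' h
    refine Subtype.ext (funext fun c => ?_)
    by_cases hc : c ∈ lam.cells
    · simpa using congrFun (congrArg Subtype.val h) ⟨c, hc⟩
    · rw [T.2.2.1 c hc, T'.2.2.1 c hc]
  · rintro ⟨T, h₁, h₂⟩
    refine ⟨⟨fun c => if h : c ∈ lam.cells then T ⟨c, h⟩ else q, ?_, ?_, ?_⟩, ?_⟩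
    · intro c hc
      simp [hc]
    · intro c hc
      simp [hc]
    · intro c hc d hd hcd
      simp only [hc, hd, dif_pos]
      rcases hcd with h | h
      · exact h₁ ⟨c, hc⟩ ⟨d, hd⟩ h.1 h.2
      · exact h₂ ⟨c, hc⟩ ⟨d, hd⟩ h.1 h.2
    · refine Subtype.ext (funext fun c => ?_)
      simp

/-! ### Identification of `numStdSetValued` with `walkCount`. -/

/-- The number of walks of length `n` from `∅` to `A` in Young's lattice, where each step adds a
box or stays in place and marks a corner. -/
noncomputable def walkCount : ℕ → Finset (ℕ × ℕ) → ℕ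
  | 0, A => if A = ∅ then 1 else 0
  | n + 1, A => ∑ b ∈ corners A, (walkCount n (A.erase b) + walkCount n A)

lemma walkCount_succ (n : ℕ) (A : Finset (ℕ × ℕ)) :
    walkCount (n + 1) A = ∑ b ∈ corners A, (walkCount n (A.erase b) + walkCount n A) := rfl

/-- A standard set-valued tableau of shape `A`, recorded as the sequence of the boxes of its
labels. -/
abbrev BoxWord (n : ℕ) (A : Finset (ℕ × ℕ)) : Type :=
  {w : Fin n → ℕ × ℕ // (∀ c, c ∈ A ↔ ∃ k, w k = c) ∧ ∀ k l, NextBox (w k) (w l) → k < l}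

instance (n : ℕ) (A : Finset (ℕ × ℕ)) : Finite (BoxWord n A) := by
  refine Finite.of_injective (β := Fin n → A) (fun w k => ⟨w.1 k, (w.2.1 _).2 ⟨k, rfl⟩⟩)
    fun w w' h => Subtype.ext (funext fun k => ?_)
  simpa using congrFun h k

lemma boxWord_snoc {n : ℕ} {A : Finset (ℕ × ℕ)} {b : ℕ × ℕ} (hb : b ∈ corners A)
    {w : Fin n → ℕ × ℕ} (h₁ : ∀ k, w k ∈ A) (h₂ : ∀ c ∈ A, c = b ∨ ∃ k, w k = c)
    (h₃ : ∀ k l, NextBox (w k) (w l) → k < l) :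
    (∀ c, c ∈ A ↔ ∃ k, (Fin.snoc w b : Fin (n + 1) → ℕ × ℕ) k = c) ∧
      ∀ k l, NextBox ((Fin.snoc w b : Fin (n + 1) → ℕ × ℕ) k)
        ((Fin.snoc w b : Fin (n + 1) → ℕ × ℕ) l) → k < l := by
  rw [mem_corners] at hb
  refine ⟨fun c => ⟨fun hc => ?_, ?_⟩, fun k l => ?_⟩
  · rcases h₂ c hc with rfl | ⟨k, rfl⟩
    · exact ⟨Fin.last n, by simp⟩
    · exact ⟨k.castSucc, by simp⟩
  · rintro ⟨k, rfl⟩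
    refine Fin.lastCases ?_ (fun k => ?_) k
    · simpa using hb.1
    · simpa using h₁ k
  · refine Fin.lastCases ?_ (fun k => ?_) k
    · refine Fin.lastCases ?_ (fun l => ?_) l
      · simp [not_nextBox_self]
      · simp only [Fin.snoc_last, Fin.snoc_castSucc]
        exact fun h => absurd (h₁ l) (hb.2 _ h)
    · refine Fin.lastCases ?_ (fun l => ?_) l
      · simp [Fin.castSucc_lt_last]
      · simpa using h₃ k l

/-- The last label sits in a corner b. If it is alone there, deleting it leaves a word for `A.erase
b`; otherwise it leaves a word for A. -/
lemma card_boxWord_succ (n : ℕ) (A : Finset (ℕ × ℕ)) :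
    Nat.card (BoxWord (n + 1) A) =
      ∑ b ∈ corners A, (Nat.card (BoxWord n (A.erase b)) + Nat.card (BoxWord n A)) := by
  rw [← Finset.sum_coe_sort]
  simp_rw [← Nat.card_sum]
  rw [← Nat.card_sigma]
  symm
  refine Nat.card_eq_of_bijective
    (fun x : (Σ b : corners A, BoxWord n (A.erase b) ⊕ BoxWord n A) =>
      ⟨Fin.snoc (Sum.elim Subtype.val Subtype.val x.2) x.1.1, ?_⟩) ⟨?_, ?_⟩
  · obtain ⟨⟨b, hb⟩, w | w⟩ := x
    · refine boxWord_snoc hb (fun k => ?_) (fun c hc => ?_) w.2.2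
      · exact Finset.mem_of_mem_erase ((w.2.1 _).2 ⟨k, rfl⟩)
      · by_cases h : c = b
        · exact Or.inl h
        · exact Or.inr ((w.2.1 c).1 (Finset.mem_erase.2 ⟨h, hc⟩))
    · exact boxWord_snoc hb (fun k => (w.2.1 _).2 ⟨k, rfl⟩) (fun c hc => Or.inr ((w.2.1 c).1 hc))
        w.2.2
  · have hne : ∀ (b : ℕ × ℕ) (_ : b ∈ corners A) (w : BoxWord n (A.erase b)) (w' : BoxWord n A),
        w.1 ≠ w'.1 := by
      intro b hb w w' h
      obtain ⟨k, hk⟩ := (w'.2.1 b).1 (corners_subset A hb)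
      exact Finset.notMem_erase b A ((w.2.1 b).2 ⟨k, by rw [h, hk]⟩)
    rintro ⟨⟨b, hb⟩, x⟩ ⟨⟨b', hb'⟩, y⟩ h
    have hs : (Fin.snoc (Sum.elim Subtype.val Subtype.val x) b : Fin (n + 1) → ℕ × ℕ) =
      Fin.snoc (Sum.elim Subtype.val Subtype.val y) b' := congrArg Subtype.val h
    obtain ⟨h', hbb⟩ := Fin.snoc_injective2 hs
    obtain rfl : b = b' := hbb
    rcases x with w | w <;> rcases y with w' | w' <;> simp only [Sum.elim_inl, Sum.elim_inr] at h'
    · rw [Subtype.ext h']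
    · exact absurd h' (hne b hb w w')
    · exact absurd h'.symm (hne b hb w' w)
    · rw [Subtype.ext h']
  · rintro ⟨w, h₁, h₂⟩
    have hb : w (Fin.last n) ∈ corners A := by
      refine mem_corners.2 ⟨(h₁ _).2 ⟨_, rfl⟩, fun d hd hdA => ?_⟩
      obtain ⟨k, rfl⟩ := (h₁ d).1 hdA
      exact absurd (h₂ _ _ hd) (not_lt.2 (Fin.le_last k))
    have hord : ∀ k l, NextBox (Fin.init w k) (Fin.init w l) → k < l := fun k l h =>
      Fin.castSucc_lt_castSucc_iff.1 (h₂ _ _ h)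
    have hA : ∀ c ∈ A, c ≠ w (Fin.last n) → ∃ k, Fin.init w k = c := by
      intro c hc hne
      obtain ⟨k, hk⟩ := (h₁ c).1 hc
      refine Fin.lastCases (fun hk => absurd hk.symm hne) (fun k hk => ⟨k, hk⟩) k hk
    by_cases h : ∃ k, Fin.init w k = w (Fin.last n)
    · refine ⟨⟨⟨_, hb⟩, Sum.inr ⟨Fin.init w, fun c => ⟨fun hc => ?_, ?_⟩, hord⟩⟩, ?_⟩
      · by_cases hcw : c = w (Fin.last n)
        · rw [hcw]; exact h
        · exact hA c hc hcw
      · rintro ⟨k, rfl⟩; exact (h₁ _).2 ⟨_, rfl⟩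
      · exact Subtype.ext (Fin.snoc_init_self w)
    · refine ⟨⟨⟨_, hb⟩, Sum.inl ⟨Fin.init w, fun c => ⟨fun hc => ?_, ?_⟩, hord⟩⟩, ?_⟩
      · rw [Finset.mem_erase] at hc
        exact hA c hc.2 hc.1
      · rintro ⟨k, rfl⟩
        exact Finset.mem_erase.2 ⟨fun hk => h ⟨k, hk⟩, (h₁ _).2 ⟨_, rfl⟩⟩
      · exact Subtype.ext (Fin.snoc_init_self w)

lemma card_boxWord (n : ℕ) (A : Finset (ℕ × ℕ)) : Nat.card (BoxWord n A) = walkCount n A := by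
  induction n generalizing A with
  | zero =>
    by_cases h : A = ∅
    · subst h
      simp only [walkCount, if_true]
      rw [Nat.card_eq_one_iff_exists]
      exact ⟨⟨Fin.elim0, by simp⟩, fun T => Subtype.ext (funext fun c => c.elim0)⟩
    · simp only [walkCount, h, if_false]
      obtain ⟨c, hc⟩ := Finset.nonempty_iff_ne_empty.2 h
      have : IsEmpty (BoxWord 0 A) := ⟨fun w => ((w.2.1 c).1 hc).elim fun k _ => k.elim0⟩
      exact Nat.card_of_isEmpty
  | succ n ih => simp only [card_boxWord_succ, walkCount_succ, ih]

lemma numStdSetValued_eq_walkCount (lam : YoungDiagram) (n : ℕ) :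
    numStdSetValued lam n = walkCount n lam.cells := by
  classical
  rw [← card_boxWord, numStdSetValued]
  symm
  refine Nat.card_eq_of_bijective
    (fun w => ⟨fun c => Finset.univ.filter fun k => w.1 k = c, ?_, ?_, ?_⟩) ⟨?_, ?_⟩
  · intro c
    obtain ⟨k, hk⟩ := (w.2.1 c).1 c.2
    exact ⟨k, by simp [hk]⟩
  · intro c d h a ha b hb
    simp only [Finset.mem_filter, Finset.mem_univ, true_and] at ha hb
    exact w.2.2 a b (by rwa [ha, hb])
  · intro k
    refine ⟨⟨w.1 k, (w.2.1 _).2 ⟨k, rfl⟩⟩, by simp, fun c hc => ?_⟩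
    simp only [Finset.mem_filter, Finset.mem_univ, true_and] at hc
    exact Subtype.ext hc.symm
  · intro w w' h
    refine Subtype.ext (funext fun k => ?_)
    have hs : (Finset.univ.filter fun l => w.1 l = w.1 k) =
        Finset.univ.filter fun l => w'.1 l = w.1 k :=
      congrFun (congrArg Subtype.val h) ⟨w.1 k, (w.2.1 _).2 ⟨k, rfl⟩⟩
    have hk : k ∈ Finset.univ.filter fun l => w'.1 l = w.1 k :=
      hs ▸ Finset.mem_filter.2 ⟨Finset.mem_univ _, rfl⟩
    exact (Finset.mem_filter.1 hk).2.symm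
  · rintro ⟨S, hS⟩
    choose f hf hf' using hS.existsUnique_box
    refine ⟨⟨fun k => (f k).1, fun c => ⟨fun hc => ?_, ?_⟩, fun k l h => ?_⟩, ?_⟩
    · obtain ⟨k, hk⟩ := hS.nonempty ⟨c, hc⟩
      exact ⟨k, (congrArg Subtype.val (hf' k _ hk)).symm⟩
    · rintro ⟨k, rfl⟩; exact (f k).2
    · exact hS.lt_next _ _ h k (hf k) l (hf l)
    · refine Subtype.ext (funext fun c => Finset.ext fun k => ?_)
      simp only [Finset.mem_filter, Finset.mem_univ, true_and]
      constructor
      · intro h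
        rw [← Subtype.ext (a1 := f k) (a2 := c) h]
        exact hf k
      · intro h
        rw [← hf' k c h]

/-! ### The growth process and its total mass. -/

open scoped Classical in
/-- The diagrams contained in the staircase `(q, …, 1)`. -/
noncomputable def subdiagrams (q : ℕ) : Finset (Finset (ℕ × ℕ)) :=
  (staircase q).cells.powerset.filter IsDiagram

lemma mem_subdiagrams {q : ℕ} {A : Finset (ℕ × ℕ)} :
    A ∈ subdiagrams q ↔ A ⊆ (staircase q).cells ∧ IsDiagram A := by
  simp [subdiagrams]

lemma addable_insert_erase {A : Finset (ℕ × ℕ)} {b : ℕ × ℕ} (hb : b ∈ addable A) :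
    (insert b A).erase b = A := Finset.erase_insert (mem_addable.1 hb).1

/-- One step of the growth process, for a weight function that vanishes outside of the
staircase. -/
lemma sum_mul_walkCount_succ (q n : ℕ) (G : Finset (ℕ × ℕ) → ℕ)
    (hG : ∀ A, IsDiagram A → G A ≠ 0 → A ⊆ (staircase q).cells) :
    ∑ A ∈ subdiagrams q, G A * walkCount (n + 1) A =
      ∑ A ∈ subdiagrams q, walkCount n A *
        (∑ b ∈ addable A, G (insert b A) + (corners A).card * G A) := by
  classical
  have hL : ∀ A ∈ subdiagrams q, G A * walkCount (n + 1) A =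
      ∑ b ∈ corners A, walkCount n (A.erase b) * G A +
        walkCount n A * ((corners A).card * G A) := by
    intro A _
    rw [walkCount_succ, Finset.sum_add_distrib, Finset.sum_const, smul_eq_mul, ← Finset.sum_mul]
    ring
  -- Steps that leave the staircase carry weight zero, so restricting to pairs inside `subdiagrams
  -- q` loses nothing.
  have hR : ∀ A ∈ subdiagrams q, walkCount n A * ∑ b ∈ addable A, G (insert b A) =
      ∑ b ∈ addable A with insert b A ∈ subdiagrams q, walkCount n A * G (insert b A) := by
    intro A hA
    rw [Finset.sum_filter_of_ne, Finset.mul_sum]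
    intro b hb hne
    have hD := (mem_subdiagrams.1 hA).2.insert hb
    exact mem_subdiagrams.2 ⟨hG _ hD (right_ne_zero_of_mul hne), hD⟩
  simp_rw [mul_add]
  rw [Finset.sum_congr rfl hL, Finset.sum_add_distrib, Finset.sum_add_distrib,
    Finset.sum_congr rfl hR]
  congr 1
  rw [Finset.sum_sigma', Finset.sum_sigma']
  refine Finset.sum_bij' (fun x _ => ⟨x.1.erase x.2, x.2⟩) (fun x _ => ⟨insert x.2 x.1, x.2⟩)
    ?_ ?_ ?_ ?_ ?_
  · rintro ⟨A, b⟩ h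
    simp only [Finset.mem_sigma, Finset.mem_filter] at h ⊢
    have hA := mem_subdiagrams.1 h.1
    have hbA := corners_subset A h.2
    refine ⟨mem_subdiagrams.2 ⟨(Finset.erase_subset _ _).trans hA.1, ?_⟩,
      hA.2.mem_addable_erase h.2, by rw [Finset.insert_erase hbA]; exact h.1⟩
    rw [Finset.erase_eq]
    exact hA.2.sdiff (by simpa using h.2)
  · rintro ⟨A, b⟩ h
    simp only [Finset.mem_sigma, Finset.mem_filter] at h ⊢
    exact ⟨h.2.2, (mem_subdiagrams.1 h.1).2.self_mem_corners_insert h.2.1⟩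
  · rintro ⟨A, b⟩ h
    simp only [Finset.mem_sigma] at h
    simp [Finset.insert_erase (corners_subset A h.2)]
  · rintro ⟨A, b⟩ h
    simp only [Finset.mem_sigma, Finset.mem_filter] at h
    simp [addable_insert_erase h.2.1]
  · rintro ⟨A, b⟩ h
    simp only [Finset.mem_sigma] at h
    simp only [Finset.insert_erase (corners_subset A h.2)]

lemma incCount_empty (q : ℕ) : incCount q ∅ = 1 := by
  induction q with
  | zero => simp [incCount]
  | succ q ih => simp [incCount_succ, corners, ih]

lemma isDiagram_empty : IsDiagram ∅ := by simp [IsDiagram, isLowerSet_empty]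

/-- The Plancherel–Hecke weights add up to `q ^ n`. -/
lemma sum_incCount_mul_walkCount (q n : ℕ) :
    ∑ A ∈ subdiagrams q, incCount q A * walkCount n A = q ^ n := by
  induction n with
  | zero =>
    rw [Finset.sum_eq_single ∅]
    · simp [incCount_empty, walkCount]
    · intro A _ hA; simp [walkCount, hA]
    · intro h
      exact absurd (mem_subdiagrams.2 ⟨Finset.empty_subset _, isDiagram_empty⟩) h
  | succ n ih =>
    rw [sum_mul_walkCount_succ q n _ fun A hA => hA.subset_staircase_of_incCount_ne_zero,
      pow_succ', ← ih, Finset.mul_sum]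
    refine Finset.sum_congr rfl fun A hA => ?_
    rw [sum_incCount_insert q (mem_subdiagrams.1 hA).2]
    ring

/-! ### The time to absorption. -/

/-- The total weight of the diagrams that are strictly contained in the staircase. -/
noncomputable def properWeight (q n : ℕ) : ℕ :=
  ∑ A ∈ (subdiagrams q).erase (staircase q).cells, incCount q A * walkCount n A

/-- The number of boxes, summed over all diagrams with their weights. -/
noncomputable def sizeWeight (q n : ℕ) : ℕ :=
  ∑ A ∈ subdiagrams q, A.card * incCount q A * walkCount n A

lemma staircase_mem_subdiagrams (q : ℕ) : (staircase q).cells ∈ subdiagrams q :=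
  mem_subdiagrams.2 ⟨subset_rfl, (staircase q).isLowerSet⟩

/-- The staircase is absorbing, so no weight returns from it to its proper subdiagrams. -/
lemma properWeight_succ_le (q n : ℕ) : properWeight q (n + 1) ≤ q * properWeight q n := by
  classical
  let G : Finset (ℕ × ℕ) → ℕ := fun A => if A = (staircase q).cells then 0 else incCount q A
  have hG : ∀ A, G A ≤ incCount q A := fun A => by simp only [G]; split_ifs <;> simp
  have hG' : ∀ A, IsDiagram A → G A ≠ 0 → A ⊆ (staircase q).cells := fun A hA h =>
    hA.subset_staircase_of_incCount_ne_zero fun h' => h (Nat.le_zero.1 (h' ▸ hG A))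
  have hmem := staircase_mem_subdiagrams q
  have hsum : ∀ n, properWeight q n = ∑ A ∈ subdiagrams q, G A * walkCount n A := by
    intro n
    rw [← Finset.add_sum_erase _ _ hmem, properWeight]
    simp only [G, if_true, zero_mul, zero_add]
    exact Finset.sum_congr rfl fun A hA => by rw [if_neg (Finset.ne_of_mem_erase hA)]
  rw [hsum, hsum, sum_mul_walkCount_succ q n G hG', Finset.mul_sum]
  refine Finset.sum_le_sum fun A hA => ?_
  have hA' := (mem_subdiagrams.1 hA).2
  by_cases h : A = (staircase q).cells
  · have h₁ : ∀ b ∈ addable A, G (insert b A) = 0 := fun b hb => by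
      by_contra hne
      have := hG' _ (hA'.insert hb) hne (Finset.mem_insert_self _ _)
      exact (mem_addable.1 hb).1 (h ▸ this)
    rw [Finset.sum_eq_zero h₁]
    simp [G, h]
  · have h₁ := sum_incCount_insert q hA'
    have h₂ : ∑ b ∈ addable A, G (insert b A) ≤ ∑ b ∈ addable A, incCount q (insert b A) :=
      Finset.sum_le_sum fun b _ => hG _
    have h₃ : G A = incCount q A := if_neg h
    rw [h₃]
    calc walkCount n A * _ ≤ walkCount n A * (q * incCount q A) :=
          Nat.mul_le_mul_left _ (by rw [← h₁]; exact Nat.add_le_add_right h₂ _)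
      _ = q * (incCount q A * walkCount n A) := by ring

/-- Growing adds one box, and a proper subdiagram has at most q - 1 corners, so at least one of its
q units of outgoing weight goes into growth. -/
lemma sizeWeight_succ_ge (q n : ℕ) :
    q * sizeWeight q n + properWeight q n ≤ sizeWeight q (n + 1) := by
  have hG : ∀ A, IsDiagram A → A.card * incCount q A ≠ 0 → A ⊆ (staircase q).cells :=
    fun A hA h => hA.subset_staircase_of_incCount_ne_zero (right_ne_zero_of_mul h)
  have hmem := staircase_mem_subdiagrams q
  have hterm : ∀ A ∈ subdiagrams q,
      ∑ b ∈ addable A, (insert b A).card * incCount q (insert b A) +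
        (corners A).card * (A.card * incCount q A) =
      A.card * (q * incCount q A) + ∑ b ∈ addable A, incCount q (insert b A) := by
    intro A hA
    rw [← sum_incCount_insert q (mem_subdiagrams.1 hA).2, mul_add, Finset.mul_sum]
    have h : ∀ b ∈ addable A, (insert b A).card * incCount q (insert b A) =
        A.card * incCount q (insert b A) + incCount q (insert b A) := fun b hb => by
      rw [Finset.card_insert_of_notMem (mem_addable.1 hb).1]; ring
    rw [Finset.sum_congr rfl h, Finset.sum_add_distrib]
    ring
  have hle : ∀ A ∈ (subdiagrams q).erase (staircase q).cells,
      incCount q A ≤ ∑ b ∈ addable A, incCount q (insert b A) := by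
    intro A hA
    rw [Finset.mem_erase, mem_subdiagrams] at hA
    have h₁ := sum_incCount_insert q hA.2.2
    have h₂ := hA.2.2.card_corners_lt hA.2.1 hA.1
    have h₃ : ((corners A).card + 1) * incCount q A ≤ q * incCount q A :=
      Nat.mul_le_mul_right _ h₂
    linarith
  calc q * sizeWeight q n + properWeight q n
      ≤ q * sizeWeight q n + ∑ A ∈ subdiagrams q,
          walkCount n A * ∑ b ∈ addable A, incCount q (insert b A) := by
        refine Nat.add_le_add_left ?_ _
        refine le_trans (Finset.sum_le_sum fun A hA => ?_)
          (Finset.sum_le_sum_of_subset (Finset.erase_subset _ _))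
        rw [mul_comm]
        exact Nat.mul_le_mul_left _ (hle A hA)
    _ = sizeWeight q (n + 1) := by
        simp only [sizeWeight]
        rw [sum_mul_walkCount_succ q n _ hG, Finset.mul_sum, ← Finset.sum_add_distrib]
        refine Finset.sum_congr rfl fun A hA => ?_
        rw [hterm A hA]
        ring

lemma sizeWeight_le (q n : ℕ) : sizeWeight q n ≤ q ^ 2 * q ^ n := by
  rw [sizeWeight, ← sum_incCount_mul_walkCount q n, Finset.mul_sum]
  refine Finset.sum_le_sum fun A hA => ?_
  rw [mul_assoc]
  refine Nat.mul_le_mul_right _ ?_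
  refine (Finset.card_le_card (mem_subdiagrams.1 hA).1).trans ?_
  refine (Finset.card_filter_le _ _).trans ?_
  rw [Finset.card_product, Finset.card_range, sq]

/-- After division by `q ^ n`: as P_k does not increase, n P_n is at most P_0 + ⋯ + P_{n-1}, hence
at most q times the expected size. -/
lemma mul_properWeight_le (q n : ℕ) : n * properWeight q n ≤ q * sizeWeight q n := by
  induction n with
  | zero => simp
  | succ n ih =>
    calc (n + 1) * properWeight q (n + 1) ≤ (n + 1) * (q * properWeight q n) :=
          Nat.mul_le_mul_left _ (properWeight_succ_le q n)
      _ = q * (n * properWeight q n + properWeight q n) := by ring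
      _ ≤ q * (q * sizeWeight q n + properWeight q n) := by gcongr
      _ ≤ q * sizeWeight q (n + 1) := Nat.mul_le_mul_left _ (sizeWeight_succ_ge q n)

/-- The time to fill the staircase is at most of order `q ^ 3`. -/
lemma mul_properWeight_le_pow (q n : ℕ) : n * properWeight q n ≤ q ^ 3 * q ^ n :=
  (mul_properWeight_le q n).trans <|
    (Nat.mul_le_mul_left q (sizeWeight_le q n)).trans_eq (by ring)

/-! ### From weights to the measure. -/

lemma prob_eq_zero {n q : ℕ} {lam : YoungDiagram} (h : ¬ lam ≤ staircase q) :
    prob n q lam = 0 := by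
  have : incCount q lam.cells = 0 := by
    by_contra hne
    exact h (IsDiagram.subset_staircase_of_incCount_ne_zero lam.isLowerSet hne)
  simp [prob, numInc_eq_incCount, this]

lemma tsum_prob_indicator (n q : ℕ) (P : YoungDiagram → Prop) [DecidablePred P] :
    ∑' lam, (if P lam then (prob n q lam : ℝ≥0∞) else 0) =
      ∑ A ∈ (subdiagrams q).attach, if P ⟨A.1, (mem_subdiagrams.1 A.2).2⟩ then
        (prob n q ⟨A.1, (mem_subdiagrams.1 A.2).2⟩ : ℝ≥0∞) else 0 := by
  classical
  have hinj : Function.Injective fun A : subdiagrams q =>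
      (⟨A.1, (mem_subdiagrams.1 A.2).2⟩ : YoungDiagram) := fun A B h =>
    Subtype.ext (congrArg YoungDiagram.cells h)
  rw [tsum_eq_sum (s := (subdiagrams q).attach.map ⟨_, hinj⟩), Finset.sum_map]
  · rfl
  · intro lam hlam
    have : ¬ lam ≤ staircase q := fun h => hlam <| Finset.mem_map.2
      ⟨⟨lam.cells, mem_subdiagrams.2 ⟨h, lam.isLowerSet⟩⟩, Finset.mem_attach _ _, rfl⟩
    simp [prob_eq_zero this]

lemma plancherelHecke_apply (n q : ℕ) (s : Set YoungDiagram) [DecidablePred (· ∈ s)] :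
    plancherelHecke n q s = ∑' lam, if lam ∈ s then (prob n q lam : ℝ≥0∞) else 0 := by
  rw [plancherelHecke, Measure.sum_apply _ MeasurableSpace.measurableSet_top]
  refine tsum_congr fun lam => ?_
  rw [Measure.smul_apply, Measure.dirac_apply' _ MeasurableSpace.measurableSet_top]
  by_cases h : lam ∈ s <;> simp [h]

lemma plancherelHecke_singleton (n q : ℕ) (lam : YoungDiagram) :
    plancherelHecke n q {lam} = prob n q lam := by
  classical
  rw [plancherelHecke_apply, tsum_eq_single lam]
  · simp
  · intro μ hμ; simp [hμ]

lemma coe_prob {n q : ℕ} (hq : 0 < q) (lam : YoungDiagram) :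
    (prob n q lam : ℝ≥0∞) =
      ((incCount q lam.cells * walkCount n lam.cells : ℕ) : ℝ≥0∞) / (q : ℝ≥0∞) ^ n := by
  rw [prob, numInc_eq_incCount, numStdSetValued_eq_walkCount, ENNReal.coe_div (by positivity)]
  push_cast
  rfl

lemma plancherelHecke_univ {q : ℕ} (hq : 0 < q) (n : ℕ) : plancherelHecke n q Set.univ = 1 := by
  classical
  have h := tsum_prob_indicator n q (· ∈ Set.univ)
  rw [plancherelHecke_apply, h]
  simp only [Set.mem_univ, if_true, coe_prob hq, div_eq_mul_inv]
  rw [← Finset.sum_mul,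
    Finset.sum_attach (subdiagrams q) fun A => ((incCount q A * walkCount n A : ℕ) : ℝ≥0∞),
    ← Nat.cast_sum, sum_incCount_mul_walkCount, Nat.cast_pow]
  exact ENNReal.mul_inv_cancel (by simp; omega) (by simp)

instance isProbabilityMeasure_plancherelHecke (n q : ℕ) [NeZero q] :
    IsProbabilityMeasure (plancherelHecke n q) := ⟨plancherelHecke_univ (NeZero.pos q) n⟩

lemma plancherelHecke_compl_staircase {q : ℕ} (hq : 0 < q) (n : ℕ) :
    plancherelHecke n q {staircase q}ᶜ = (properWeight q n : ℝ≥0∞) / (q : ℝ≥0∞) ^ n := by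
  classical
  have h := tsum_prob_indicator n q (· ∈ ({staircase q}ᶜ : Set YoungDiagram))
  rw [plancherelHecke_apply, h]
  have hne : ∀ A : subdiagrams q, (⟨A.1, (mem_subdiagrams.1 A.2).2⟩ : YoungDiagram) ∈
      ({staircase q}ᶜ : Set YoungDiagram) ↔ A.1 ≠ (staircase q).cells := fun A => by
    simp [YoungDiagram.ext_iff]
  simp only [hne, coe_prob hq]
  rw [Finset.sum_attach (subdiagrams q) fun A => if A ≠ (staircase q).cells then
      ((incCount q A * walkCount n A : ℕ) : ℝ≥0∞) / (q : ℝ≥0∞) ^ n else 0,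
    ← Finset.sum_filter, Finset.filter_ne']
  simp only [div_eq_mul_inv]
  rw [← Finset.sum_mul, properWeight, Nat.cast_sum]

lemma plancherelHecke_compl_staircase_le {q n : ℕ} (hq : 0 < q) (hn : 0 < n) :
    plancherelHecke n q {staircase q}ᶜ ≤ ENNReal.ofReal ((q : ℝ) ^ 3 / n) := by
  rw [plancherelHecke_compl_staircase hq]
  have h : (n : ℝ) * properWeight q n ≤ (q : ℝ) ^ 3 * (q : ℝ) ^ n := by
    exact_mod_cast mul_properWeight_le_pow q n
  have hn' : (0 : ℝ) < n := by exact_mod_cast hn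
  have hq' : (0 : ℝ) < (q : ℝ) ^ n := by positivity
  have hEq : (properWeight q n : ℝ≥0∞) / (q : ℝ≥0∞) ^ n =
      ENNReal.ofReal ((properWeight q n : ℝ) / (q : ℝ) ^ n) := by
    rw [ENNReal.ofReal_div_of_pos hq', ENNReal.ofReal_natCast,
      ENNReal.ofReal_pow (Nat.cast_nonneg _), ENNReal.ofReal_natCast]
  rw [hEq]
  refine ENNReal.ofReal_le_ofReal ?_
  rw [div_le_div_iff₀ hq' hn']
  linarith

/-! ### The profile of the staircase. -/

lemma rowLen_staircase (q i : ℕ) : (staircase q).rowLen i = q - i := by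
  have h : ∀ j, j < (staircase q).rowLen i ↔ i + j < q := fun j => by
    rw [← YoungDiagram.mem_iff_lt_rowLen, ← YoungDiagram.mem_cells, mem_staircase]
  have h₁ := h ((staircase q).rowLen i)
  have h₂ := h ((staircase q).rowLen i - 1)
  omega

lemma profile_staircase (q : ℕ) (x : ℝ≥0) :
    profile (staircase q) x = max ((q : ℝ) - x) 0 := by
  have hfl : ((⌊x⌋₊ : ℕ) : ℝ) + Int.fract (x : ℝ) = x := by
    have h₁ := Int.floor_add_fract (x : ℝ)
    have h₂ : ((⌊(x : ℝ)⌋₊ : ℕ) : ℝ) = (⌊(x : ℝ)⌋ : ℝ) :=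
      natCast_floor_eq_intCast_floor x.coe_nonneg
    have h₃ : ⌊(x : ℝ)⌋₊ = ⌊x⌋₊ := Nonneg.nat_floor_coe x
    rw [← h₃, h₂, h₁]
  have ht₀ := Int.fract_nonneg (x : ℝ)
  have ht₁ := Int.fract_lt_one (x : ℝ)
  rw [profile, rowLen_staircase, rowLen_staircase]
  generalize Int.fract (x : ℝ) = t at *
  generalize ⌊x⌋₊ = k at *
  rw [← hfl]
  -- For k < q neither row length is truncated and the interpolation is affine; for k ≥ q both
  -- vanish. The kink at q is a lattice point.
  rcases lt_or_ge k q with hk | hk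
  · have hk' : ((k : ℝ) + 1) ≤ q := by exact_mod_cast hk
    rw [max_eq_left (by linarith), Nat.cast_sub hk.le, Nat.cast_sub (by omega)]
    push_cast
    ring
  · have hk' : (q : ℝ) ≤ k := by exact_mod_cast hk
    rw [max_eq_right (by linarith), Nat.sub_eq_zero_of_le hk, Nat.sub_eq_zero_of_le (by omega)]
    simp

lemma rescaledProfile_staircase {q : ℕ} (hq : 0 < q) (x : ℝ≥0) :
    rescaledProfile q (staircase q) x = line x := by
  have hq' : (0 : ℝ) < q := by exact_mod_cast hq
  have h : ((line x : ℝ≥0) : ℝ) = max (1 - (x : ℝ)) 0 := Real.coe_toNNReal' _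
  rw [rescaledProfile, profile_staircase, h, mul_max_of_nonneg _ _ (by positivity)]
  push_cast
  congr 1
  · field_simp
  · simp

lemma supDist_staircase_line {q : ℕ} (hq : 0 < q) : supDist q (staircase q) line = 0 := by
  simp [supDist, rescaledProfile_staircase hq]

lemma le_supDist_staircase {q : ℕ} (hq : 0 < q) (Λ : C(ℝ≥0, ℝ≥0)) (x : ℝ≥0) :
    ENNReal.ofReal |(line x : ℝ) - Λ x| ≤ supDist q (staircase q) Λ := by
  rw [← rescaledProfile_staircase hq]
  exact le_iSup (fun x => ENNReal.ofReal |rescaledProfile q (staircase q) x - (Λ x : ℝ)|) x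

/-! ### Asymptotics and the three conclusions. -/

lemma eventually_pos_of_isTheta_rpow {α : ℝ} {q : ℕ → ℕ}
    (hq : (fun n : ℕ => (q n : ℝ)) =Θ[atTop] fun n : ℕ => (n : ℝ) ^ α) :
    ∀ᶠ n in atTop, 0 < q n := by
  filter_upwards [hq.eq_zero_iff, eventually_gt_atTop 0] with n h hn
  have hn' : (0 : ℝ) < n := by exact_mod_cast hn
  refine Nat.pos_of_ne_zero fun h₀ => (Real.rpow_pos_of_pos hn' α).ne' (h.1 ?_)
  simp [h₀]

lemma tendsto_pow_three_div {α : ℝ} (hα : α < 1 / 3) {q : ℕ → ℕ}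
    (hq : (fun n : ℕ => (q n : ℝ)) =O[atTop] fun n : ℕ => (n : ℝ) ^ α) :
    Tendsto (fun n : ℕ => (q n : ℝ) ^ 3 / n) atTop (𝓝 0) := by
  have h₁ : (fun n : ℕ => (q n : ℝ) ^ 3 / n) =O[atTop]
      fun n : ℕ => ((n : ℝ) ^ α) ^ 3 * (n : ℝ)⁻¹ := by
    simp_rw [div_eq_mul_inv]
    exact (hq.pow 3).mul (isBigO_refl _ _)
  have h₂ : (fun n : ℕ => ((n : ℝ) ^ α) ^ 3 * (n : ℝ)⁻¹) =ᶠ[atTop]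
      fun n : ℕ => (n : ℝ) ^ (-(1 - α * 3)) := by
    filter_upwards [eventually_gt_atTop 0] with n hn
    have hn' : (0 : ℝ) < n := by exact_mod_cast hn
    rw [← Real.rpow_natCast, ← Real.rpow_mul hn'.le, ← Real.rpow_neg_one, ← Real.rpow_add hn']
    congr 1
    push_cast
    ring
  refine (h₁.trans_eventuallyEq h₂).trans_tendsto ?_
  exact (tendsto_rpow_neg_atTop (by linarith)).comp tendsto_natCast_atTop_atTop

lemma tendsto_plancherelHecke_compl_staircase {α : ℝ} (hα : α < 1 / 3) {q : ℕ → ℕ}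
    (hq : (fun n : ℕ => (q n : ℝ)) =Θ[atTop] fun n : ℕ => (n : ℝ) ^ α) :
    Tendsto (fun n => plancherelHecke n (q n) {staircase (q n)}ᶜ) atTop (𝓝 0) := by
  have h := ENNReal.tendsto_ofReal (tendsto_pow_three_div hα hq.1)
  rw [ENNReal.ofReal_zero] at h
  refine tendsto_of_tendsto_of_tendsto_of_le_of_le' tendsto_const_nhds h
    (Eventually.of_forall fun _ => zero_le) ?_
  filter_upwards [eventually_pos_of_isTheta_rpow hq, eventually_gt_atTop 0] with n h₁ h₂
  exact plancherelHecke_compl_staircase_le h₁ h₂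

lemma tendsto_plancherelHecke_staircase {α : ℝ} (hα : α < 1 / 3) {q : ℕ → ℕ}
    (hq : (fun n : ℕ => (q n : ℝ)) =Θ[atTop] fun n : ℕ => (n : ℝ) ^ α) :
    Tendsto (fun n => plancherelHecke n (q n) {staircase (q n)}) atTop (𝓝 1) := by
  have h := ENNReal.Tendsto.sub (tendsto_const_nhds (x := (1 : ℝ≥0∞)))
    (tendsto_plancherelHecke_compl_staircase hα hq) (Or.inl ENNReal.one_ne_top)
  rw [tsub_zero] at h
  refine h.congr' ?_
  filter_upwards [eventually_pos_of_isTheta_rpow hq] with n hn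
  have : NeZero (q n) := ⟨hn.ne'⟩
  rw [← prob_compl_eq_one_sub MeasurableSpace.measurableSet_top, compl_compl]

/-- Any other single shape has at most the mass of the whole complement of the staircase. -/
lemma isTypicalShape_iff_eq_staircase {n q : ℕ}
    (h : plancherelHecke n q {staircase q}ᶜ < plancherelHecke n q {staircase q})
    (lam : YoungDiagram) : IsTypicalShape n q lam ↔ lam = staircase q := by
  have hlt : ∀ ν, ν ≠ staircase q → prob n q ν < prob n q (staircase q) := fun ν hν => by
    rw [← ENNReal.coe_lt_coe, ← plancherelHecke_singleton, ← plancherelHecke_singleton]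
    exact (measure_mono (by simpa using hν.symm)).trans_lt h
  constructor
  · intro hlam
    by_contra hne
    exact absurd (hlam.2 _ le_rfl) (not_le.2 (hlt lam hne))
  · rintro rfl
    refine ⟨le_rfl, fun ν _ => ?_⟩
    by_cases hν : ν = staircase q
    · rw [hν]
    · exact (hlt ν hν).le

lemma isLimitShape_line {q : ℕ → ℕ} (hq : ∀ᶠ n in atTop, 0 < q n)
    (h : Tendsto (fun n => plancherelHecke n (q n) {staircase (q n)}ᶜ) atTop (𝓝 0)) :
    IsLimitShape q line := by
  intro ε _
  refine tendsto_of_tendsto_of_tendsto_of_le_of_le' tendsto_const_nhds h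
    (Eventually.of_forall fun _ => zero_le) ?_
  filter_upwards [hq] with n hn
  refine measure_mono fun lam hlam => ?_
  rintro rfl
  simp [supDist_staircase_line hn] at hlam

lemma IsLimitShape.eq_line {q : ℕ → ℕ} (hq : ∀ᶠ n in atTop, 0 < q n)
    (h : Tendsto (fun n => plancherelHecke n (q n) {staircase (q n)}) atTop (𝓝 1))
    {Λ : C(ℝ≥0, ℝ≥0)} (hΛ : IsLimitShape q Λ) : Λ = line := by
  by_contra hne
  obtain ⟨x, hx⟩ : ∃ x, Λ x ≠ line x := by
    by_contra! hall
    exact hne (ContinuousMap.ext hall)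
  have hpos : 0 < |(line x : ℝ) - Λ x| :=
    abs_pos.2 (sub_ne_zero.2 fun h => hx (NNReal.coe_injective h.symm))
  have hle := hΛ _ (half_pos hpos)
  -- At a point where Λ differs from the line, the staircase deviates from Λ by more than half the
  -- gap. The deviation event thus contains the staircase, forcing 1 ≤ 0 in the limit.
  refine absurd (le_of_tendsto_of_tendsto h hle ?_) (by simp)
  filter_upwards [hq] with n hn
  refine measure_mono (Set.singleton_subset_iff.2 ?_)
  exact ((ENNReal.ofReal_lt_ofReal_iff hpos).2 (half_lt_self hpos)).trans_le
    (le_supDist_staircase hn Λ x)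

end PlancherelHecke

theorem theorem1p6 (α : ℝ) (hα₀ : 0 ≤ α) (hα : α < 1 / 3) (q : ℕ → ℕ)
    (hq : (fun n : ℕ => (q n : ℝ)) =Θ[atTop] fun n : ℕ => (n : ℝ) ^ α) :
    -- a random shape is the full staircase with probability tending to one
    (Tendsto (fun n => plancherelHecke n (q n) {staircase (q n)}) atTop (𝓝 1) ∧
      Tendsto (fun n => plancherelHecke n (q n) {staircase (q n)}ᶜ) atTop (𝓝 0)) ∧
    -- the limit shape exists, is unique, and is the line
    (IsLimitShape q line ∧ ∀ Λ : C(ℝ≥0, ℝ≥0), IsLimitShape q Λ → Λ = line) ∧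
    -- for large `n` the typical shape is the staircase, and its rescaling tends to the line
    ((∀ᶠ n in atTop, ∀ lam, IsTypicalShape n (q n) lam ↔ lam = staircase (q n)) ∧
      ∀ L : ℕ → YoungDiagram, (∀ n, IsTypicalShape n (q n) (L n)) →
        Tendsto (fun n => supDist (q n) (L n) line) atTop (𝓝 0)) := by
  have hpos := eventually_pos_of_isTheta_rpow hq
  have hcompl := tendsto_plancherelHecke_compl_staircase hα hq
  have hone := tendsto_plancherelHecke_staircase hα hq
  have htyp : ∀ᶠ n in atTop, ∀ lam, IsTypicalShape n (q n) lam ↔ lam = staircase (q n) := by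
    filter_upwards [hcompl.eventually_lt hone zero_lt_one] with n hn lam
    exact isTypicalShape_iff_eq_staircase hn lam
  refine ⟨⟨hone, hcompl⟩, ⟨isLimitShape_line hpos hcompl, fun Λ hΛ => hΛ.eq_line hpos hone⟩,
    htyp, fun L hL => tendsto_const_nhds.congr' ?_⟩
  filter_upwards [htyp, hpos] with n h₁ h₂
  rw [(h₁ (L n)).1 (hL n), supDist_staircase_line h₂]
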